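/- Write $\mathbb N_\infty=\mathbb N\cup\{\infty\}$. All Banach spaces are real. **Banach stackings.** Let $(X_n,\|\cdot\|_n)_{n\in\mathbb N_\infty}$ be Banach spaces, $(\mathcal M,d)$ a metric space and $\xi_n:X_n\to\mathcal M$ ($n\in\mathbb N_\infty$) maps. For $x_n\in X_n$ ($n\in\mathbb N_\infty$) write $x_n\twoheadrightarrow x_\infty$ if $\xi_n(x_n)\to\xi_\infty(x_\infty)$ in $\mathcal M$ as $n\to\infty$. Then $((X_n,\xi_n)_{n\in\mathbb N_\infty},\mathcal M)$ is a *Banach stacking* if: (i) every $\xi_n$ is $1$-Lipschitz; (ii) for every $x_\infty\in X_\infty$ there are $x_n\in X_n$ ($n\in\mathbb N$) with $x_n\twoheadrightarrow x_\infty$; (iii) $x_n\twoheadrightarrow x_\infty$ and $y_n\twoheadrightarrow y_\infty$ imply $x_n+y_n\twoheadrightarrow x_\infty+y_\infty$ and $\lambda x_n\twoheadrightarrow\lambda x_\infty$ for all $\lambda\in\mathbb R$; (iv) $x_n\twoheadrightarrow x_\infty$ implies $\|x_n\|_n\to\|x_\infty\|_\infty$. **Operators.** An operator on a Banach space $X$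 is a subset $A\subset X\times X$; $y\in A(x)$ means $(x,y)\in A$, and $D(A)=\{x: A(x)\ne\emptyset\}$. Write $I$ for the identity operator. Sums and real multiples are $A+B=\{(x,y+z):y\in A(x),\,z\in B(x)\}$ and $\lambda A=\{(x,\lambda y):y\in A(x)\}$. The resolvent is $R_\lambda(A)=(I+\lambda A)^{-1}$, the inverse being taken as a relation. $A$ is *accretive* if $\|x-\hat x+\lambda(y-\hat y)\|\ge\|x-\hat x\|$ for all $(x,y),(\hat x,\hat y)\in A$ and $\lambda>0$, and *$\omega$-accretive* ($\omega\in\mathbb R$) if $A+\omega I$ is accretive. $A$ satisfies the *range condition* if there is a $\delta>0$ with $\overline{D(A)}\subset\operatorname{Range}(I+\lambda A)$ for all $\lambda\in(0,\delta)$. Put $\mathfrak I_\omega=(0,1/\omega)$ if $\omega>0$ and $\mathfrak I_\omega=(0,\infty)$ if $\omega\le 0$; if $A$ is $\omega$-accretive and $\lambda\in\mathfrak I_\omega$, then $R_\lambda(A)$ is single-valued on its domain $\operatorname{Range}(I+\lambda A)$. **Semigroups.** Consider the problem $u'+Au\ni0$, $u(0)=x$. For $T,\varepsilon>0$ an *$\varepsilon$-approximate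 solution* on $[0,T]$ consists of an integer $N\ge1$, times $0=t_0<\dots<t_N\le T$ with $t_i-t_{i-1}\le\varepsilon$ and $t_N>T-\varepsilon$, and $v_0,\dots,v_N,\theta_1,\dots,\theta_N\in X$ with $\|v_0-x\|\le\varepsilon$, $\theta_i\in\frac{v_i-v_{i-1}}{t_i-t_{i-1}}+A(v_i)$ for $1\le i\le N$, and $\sum_{i=1}^N(t_i-t_{i-1})\|\theta_i\|\le\varepsilon$. Its interpolation $\bar v$ on $[0,T]$ is $\bar v(0)=v_0$, $\bar v=v_i$ on $(t_{i-1},t_i]$, $\bar v=v_N$ on $(t_N,T]$. A *mild solution* on $[0,\infty)$ is a continuous $u:[0,\infty)\to X$ with $u(0)=x$ such that for all $T>0$ and $\varepsilon>0$ there is an $\varepsilon$-approximate solution on $[0,T]$ with $\|u(t)-\bar v(t)\|\le\varepsilon$ for all $t\in[0,T]$. Let $D(S_A)$ be the set of $x\in X$ for which there is a unique mild solution $u$ on $[0,\infty)$, and for such $x$ set $S_A(t)x=u(t)$, $t\ge0$. **Theorem (Brezis–Pazy for Banach stackings).** Let $((X_n,\xi_n)_{n\in\mathbb N_\infty},\mathcal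 M)$ be a Banach stacking, let $\omega\in\mathbb R$ and let $\omega_n\le\omega$ be real numbers ($n\in\mathbb N_\infty$). For each $n\in\mathbb N_\infty$ let $A_n$ be an $\omega_n$-accretive operator on $X_n$ that satisfies the range condition. Assume that there is a $\delta\in\mathfrak I_\omega$ such that, for all $\lambda\in(0,\delta)$ and all $z_n\in\overline{D(A_n)}$ ($n\in\mathbb N_\infty$) with $z_n\twoheadrightarrow z_\infty$, the elements $R_\lambda(A_n)z_n$ are defined for all $n\in\mathbb N_\infty$ and $R_\lambda(A_n)z_n\twoheadrightarrow R_\lambda(A_\infty)z_\infty$. Then, for all $x_n\in\overline{D(A_n)}$ ($n\in\mathbb N_\infty$) with $x_n\twoheadrightarrow x_\infty$, one has $x_n\in D(S_{A_n})$ for all $n\in\mathbb N_\infty$, and $S_{A_n}(t)x_n\twoheadrightarrow S_{A_\infty}(t)x_\infty$ for all $t\ge0$. Moreover, for every $T\in[0,\infty)$ this convergence is uniform on $[0,T]$: $$\sup_{t\in[0,T]}d\big(\xi_n(S_{A_n}(t)x_n),\,\xi_\infty(S_{A_\infty}(t)x_\infty)\big)\to0\qquad(n\to\infty).$$ -/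

import Mathlib

open Set Filter Topology

namespace BanachStacking

/-! ### Operators: subsets of `X × X`, i.e. relations on `X` -/

section Operators

variable {X : Type*} [NormedAddCommGroup X] [NormedSpace ℝ X]

/-- The sum `A + B = {(x, y + z) | (x, y) ∈ A, (x, z) ∈ B}` of two operators. -/
def opAdd (A B : SetRel X X) : SetRel X X :=
  {p | ∃ y z : X, (p.1, y) ∈ A ∧ (p.1, z) ∈ B ∧ p.2 = y + z}

/-- The multiple `c A = {(x, c y) | (x, y) ∈ A}` of an operator. -/
def opSMul (c : ℝ) (A : SetRel X X) : SetRel X X :=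
  {p | ∃ y : X, (p.1, y) ∈ A ∧ p.2 = c • y}

/-- The operator `I + c A`. -/
def idAddSMul (c : ℝ) (A : SetRel X X) : SetRel X X :=
  opAdd SetRel.id (opSMul c A)

/-- The resolvent `R_c(A) = (I + c A)⁻¹`, again an operator (a subset of `X × X`). -/
def opResolvent (c : ℝ) (A : SetRel X X) : SetRel X X :=
  (idAddSMul c A).inv

/-- Accretivity with respect to the norm of `X`. -/
def IsAccretive (A : SetRel X X) : Prop :=
  ∀ x y x' y' : X, (x, y) ∈ A → (x', y') ∈ A → ∀ c : ℝ, 0 < c →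
    ‖x - x'‖ ≤ ‖x - x' + c • (y - y')‖

/-- `A` is `ω`-accretive if `A + ω I` is accretive. -/
def IsOmegaAccretive (ω : ℝ) (A : SetRel X X) : Prop :=
  IsAccretive (opAdd A (opSMul ω SetRel.id))

/-- The range condition: for some `δ > 0`, the range of `I + c A` contains the closure of the
domain of `A` for every `c ∈ (0, δ)`. -/
def RangeCondition (A : SetRel X X) : Prop :=
  ∃ δ : ℝ, 0 < δ ∧ ∀ c ∈ Ioo (0 : ℝ) δ, closure A.dom ⊆ (idAddSMul c A).cod

end Operators

/-- The interval `(0, 1/ω)` if `ω > 0`, and `(0, ∞)` if `ω ≤ 0`. -/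
def omegaInterval (ω : ℝ) : Set ℝ :=
  {c | 0 < c ∧ (0 < ω → c < 1 / ω)}

/-! ### Mild solutions of `u' + A u ∋ 0`, `u(0) = x`, and the semigroup generated by `A` -/

section Semigroups

variable {X : Type*} [NormedAddCommGroup X] [NormedSpace ℝ X]

/-- `0 = t 0 < t 1 < ⋯ < t N ≤ T` is an `ε`-discretization of `[0, T]` of size `N ≥ 1`. Only the
values `t i` with `i ≤ N` are relevant. -/
structure IsDiscretization (T ε : ℝ) (N : ℕ) (t : ℕ → ℝ) : Prop where
  one_le : 1 ≤ N
  zero : t 0 = 0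
  lt_succ : ∀ i < N, t i < t (i + 1)
  mesh_le : ∀ i < N, t (i + 1) - t i ≤ ε
  lt_last : T - ε < t N
  last_le : t N ≤ T

/-- `v i` and `θ i` (`i ≤ N`) are the values at `t i` of an `ε`-approximate solution of
`u' + A u ∋ 0`, `u(0) = x` on `[0, T]`: each backward difference quotient satisfies
`(v (i+1) - v i) / (t (i+1) - t i) + A (v (i+1)) ∋ θ (i+1)`. -/
structure IsApproxSolution (A : SetRel X X) (x : X) (T ε : ℝ) (N : ℕ) (t : ℕ → ℝ)
    (v θ : ℕ → X) : Prop where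
  discretization : IsDiscretization T ε N t
  theta_zero : θ 0 = 0
  initial : ‖v 0 - x‖ ≤ ε
  step : ∀ i < N, ∃ y : X, (v (i + 1), y) ∈ A ∧
    (t (i + 1) - t i)⁻¹ • (v (i + 1) - v i) + y = θ (i + 1)
  error : ∑ i ∈ Finset.range N, (t (i + 1) - t i) * ‖θ (i + 1)‖ ≤ ε

/-- `u` is within `ε`, everywhere on `[0, T]`, of the piecewise constant interpolation of `v`,
which is `v 0` at `0`, `v (i+1)` on `(t i, t (i+1)]` and `v N` on `(t N, T]`. -/
def IsNearInterpolation (u : ℝ → X) (T ε : ℝ) (N : ℕ) (t : ℕ → ℝ) (v : ℕ → X) : Prop :=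
  ‖u 0 - v 0‖ ≤ ε ∧
  (∀ i < N, ∀ s ∈ Ioc (t i) (t (i + 1)), ‖u s - v (i + 1)‖ ≤ ε) ∧
  (∀ s ∈ Ioc (t N) T, ‖u s - v N‖ ≤ ε)

/-- `u` is a mild solution of `u' + A u ∋ 0`, `u(0) = x` on `[0, T]`. -/
def IsMildSolutionOn (A : SetRel X X) (x : X) (T : ℝ) (u : ℝ → X) : Prop :=
  ContinuousOn u (Icc 0 T) ∧ u 0 = x ∧
  ∀ ε : ℝ, 0 < ε → ∃ (N : ℕ) (t : ℕ → ℝ) (v θ : ℕ → X),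
    IsApproxSolution A x T ε N t v θ ∧ IsNearInterpolation u T ε N t v

/-- `u` is a mild solution of `u' + A u ∋ 0`, `u(0) = x` on `[0, ∞)`. Only the values `u t` with
`t ≥ 0` are relevant. -/
def IsMildSolution (A : SetRel X X) (x : X) (u : ℝ → X) : Prop :=
  ∀ T : ℝ, 0 < T → IsMildSolutionOn A x T u

/-- The domain `D(S_A)`: all `x` for which there is a unique mild solution on `[0, ∞)`. -/
def semigroupDomain (A : SetRel X X) : Set X :=
  {x | ∃ u : ℝ → X, IsMildSolution A x u ∧
    ∀ w : ℝ → X, IsMildSolution A x w → EqOn w u (Ici 0)}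

open Classical in
/-- The semigroup generated by `A`: for `x ∈ D(S_A)` and `t ≥ 0`, `S_A(t) x` is the value at `t`
of the unique mild solution starting at `x` (and a dummy value for `x ∉ D(S_A)`). -/
noncomputable def semigroup (A : SetRel X X) (t : ℝ) (x : X) : X :=
  if h : x ∈ semigroupDomain A then h.choose t else 0

end Semigroups

/-! ### Banach stackings -/

section Stackings

variable {X : ℕ∞ → Type*} {M : Type*} [MetricSpace M]

/-- Convergence `x_n ↠ x_∞` of `(x_n)_{n ∈ ℕ ∪ {∞}}`: `ξ_n (x_n) → ξ_∞ (x_∞)` in `M`. -/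
def Converges (ξ : ∀ n, X n → M) (x : ∀ n, X n) : Prop :=
  Tendsto (fun n : ℕ => ξ (n : ℕ∞) (x n)) atTop (𝓝 (ξ ⊤ (x ⊤)))

/-- Banach stackings, indexed by `ℕ∞ = ℕ ∪ {⊤}`, with limit space `X ⊤`. Completeness of the
spaces `X n` is a separate assumption. -/
structure IsBanachStacking [∀ n, NormedAddCommGroup (X n)] [∀ n, NormedSpace ℝ (X n)]
    (ξ : ∀ n, X n → M) : Prop where
  lipschitz : ∀ n, LipschitzWith 1 (ξ n)
  exists_converges : ∀ a : X ⊤, ∃ x : ∀ n, X n, x ⊤ = a ∧ Converges ξ x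
  add : ∀ x y : ∀ n, X n, Converges ξ x → Converges ξ y → Converges ξ (fun n => x n + y n)
  smul : ∀ (c : ℝ) (x : ∀ n, X n), Converges ξ x → Converges ξ (fun n => c • x n)
  norm : ∀ x : ∀ n, X n, Converges ξ x →
    Tendsto (fun n : ℕ => ‖x (n : ℕ∞)‖) atTop (𝓝 ‖x ⊤‖)

end Stackings

end BanachStacking

/-! The semigroup is the limit of implicit Euler schemes. For a fixed step `h`, finitely many
resolvent steps cover `[0, T]`, so by hypothesis the Euler values converge along the stacking,
uniformly over the grid. What remains is a bound, uniform in `n`, on the distance from semigroup to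
scheme.

Kobayashi's comparison `IsApproxSolution.norm_sub_le` bounds the distance of two approximate
solutions through any single `(z, w) ∈ A`: only `‖x - z‖` and `‖w‖` enter, the latter with a factor
that is small for fine meshes and close times. It makes Euler schemes Cauchy and mild solutions
unique, and gives `IsMildSolutionOn.norm_sub_euler_le`.

Uniformity in `n` comes from `z_n = R_c(A_n) x_n` and `w_n = (x_n - z_n) / c` with one small `c`.
Since `x_n - z_n ↠ x_∞ - z_∞`, the norms converge, so `‖x_∞ - z_∞‖ < r` passes to all large `n`, and
then `‖w_n‖ ≤ r / c`. The 1-Lipschitz maps `ξ_n` carry the estimates to `M`. -/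

namespace BanachStacking

/-! ### Accretivity inequalities for single resolvent steps -/

section Accretive

variable {X : Type*} [NormedAddCommGroup X] [NormedSpace ℝ X] {A : SetRel X X} {ω : ℝ}

lemma isOmegaAccretive_iff : IsOmegaAccretive ω A ↔
    ∀ x y x' y' : X, (x, y) ∈ A → (x', y') ∈ A → ∀ c : ℝ, 0 < c →
      ‖x - x'‖ ≤ ‖x - x' + c • (y - y' + ω • (x - x'))‖ := by
  constructor
  · intro h x y x' y' hxy hxy' c hc
    have := h x (y + ω • x) x' (y' + ω • x') ⟨y, ω • x, hxy, ⟨x, rfl, rfl⟩, rfl⟩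
      ⟨y', ω • x', hxy', ⟨x', rfl, rfl⟩, rfl⟩ c hc
    convert this using 4
    module
  · rintro h x _ x' _ ⟨y, _, hy, ⟨a, ha, rfl⟩, rfl⟩ ⟨y', _, hy', ⟨a', ha', rfl⟩, rfl⟩ c hc
    obtain rfl : x = a := ha
    obtain rfl : x' = a' := ha'
    convert h x y x' y' hy hy' c hc using 4
    module

lemma IsOmegaAccretive.mono {ω' : ℝ} (hA : IsOmegaAccretive ω A) (h : ω ≤ ω') :
    IsOmegaAccretive ω' A := by
  rw [isOmegaAccretive_iff] at hA ⊢
  intro x y x' y' hxy hxy' c hc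
  have hr : 0 ≤ c * (ω' - ω) := mul_nonneg hc.le (by linarith)
  have hpos : 0 < 1 + c * (ω' - ω) := by linarith
  have key := hA x y x' y' hxy hxy' (c / (1 + c * (ω' - ω))) (by positivity)
  have e : x - x' + c • (y - y' + ω' • (x - x')) = (1 + c * (ω' - ω)) •
      (x - x' + (c / (1 + c * (ω' - ω))) • (y - y' + ω • (x - x'))) := by
    match_scalars <;> field_simp <;> ring
  rw [e, norm_smul, Real.norm_of_nonneg hpos.le]
  nlinarith [norm_nonneg (x - x')]

lemma IsOmegaAccretive.norm_sub_le (hA : IsOmegaAccretive ω A) {x y x' y' : X}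
    (hxy : (x, y) ∈ A) (hxy' : (x', y') ∈ A) {c : ℝ} (hc : 0 < c) (hcω : c * ω < 1) :
    (1 - c * ω) * ‖x - x'‖ ≤ ‖x - x' + c • (y - y')‖ := by
  have hpos : 0 < 1 - c * ω := by linarith
  have key := isOmegaAccretive_iff.1 hA x y x' y' hxy hxy' (c / (1 - c * ω)) (by positivity)
  have e : x - x' + c • (y - y') = (1 - c * ω) •
      (x - x' + (c / (1 - c * ω)) • (y - y' + ω • (x - x'))) := by
    match_scalars <;> field_simp <;> ring
  rw [e, norm_smul, Real.norm_of_nonneg hpos.le]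
  exact mul_le_mul_of_nonneg_left key hpos.le

lemma mem_opResolvent_iff {c : ℝ} (hc : c ≠ 0) {z p : X} :
    (z, p) ∈ opResolvent c A ↔ (p, c⁻¹ • (z - p)) ∈ A := by
  constructor
  · rintro ⟨a, _, ha, ⟨y, hy, rfl⟩, hz⟩
    obtain rfl : p = a := ha
    have : z = p + c • y := hz
    rw [this, add_sub_cancel_left, inv_smul_smul₀ hc]
    exact hy
  · intro h
    refine ⟨p, z - p, rfl, ⟨_, h, (smul_inv_smul₀ hc _).symm⟩, ?_⟩
    simp

/-- The difference of a resolvent step and of a point of the operator. -/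
lemma IsOmegaAccretive.norm_step_sub_le (hA : IsOmegaAccretive ω A) {p v y θ z w : X} {h : ℝ}
    (hh : 0 < h) (hhω : h * ω < 1) (hy : (v, y) ∈ A) (hθ : h⁻¹ • (v - p) + y = θ)
    (hz : (z, w) ∈ A) :
    (1 - h * ω) * ‖v - z‖ ≤ ‖p - z‖ + h * ‖θ‖ + h * ‖w‖ := by
  refine (hA.norm_sub_le hy hz hh hhω).trans ?_
  have e : v - z + h • (y - w) = (p - z) + h • θ - h • w := by
    rw [← hθ, smul_add, smul_inv_smul₀ hh.ne']
    module
  rw [e]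
  refine (_root_.norm_sub_le _ _).trans ?_
  gcongr
  · refine (norm_add_le _ _).trans ?_
    rw [norm_smul, Real.norm_of_nonneg hh.le]
  · rw [norm_smul, Real.norm_of_nonneg hh.le]

/-- The difference of two resolvent steps of different sizes. -/
lemma IsOmegaAccretive.norm_step_sub_step_le (hA : IsOmegaAccretive ω A)
    {p v y θ q u y' θ' : X} {h k : ℝ} (hh : 0 < h) (hk : 0 < k)
    (hω : h * k / (h + k) * ω < 1) (hy : (v, y) ∈ A) (hθ : h⁻¹ • (v - p) + y = θ)
    (hy' : (u, y') ∈ A) (hθ' : k⁻¹ • (u - q) + y' = θ') :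
    (1 - h * k / (h + k) * ω) * ‖v - u‖ ≤ h / (h + k) * ‖v - q‖ + k / (h + k) * ‖p - u‖ +
      h * k / (h + k) * (‖θ‖ + ‖θ'‖) := by
  refine (hA.norm_sub_le hy hy' (by positivity) hω).trans ?_
  -- With parameter `hk/(h+k)` the quotients enter with weights `k/(h+k)` and `h/(h+k)`, so `v - u`
  -- is replaced by an average of its two grid neighbours.
  have e : v - u + (h * k / (h + k)) • (y - y') = (h / (h + k)) • (v - q) +
      (k / (h + k)) • (p - u) + (h * k / (h + k)) • (θ - θ') := by
    rw [← hθ, ← hθ']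
    match_scalars <;> field_simp <;> ring
  rw [e]
  refine (norm_add₃_le).trans ?_
  rw [norm_smul, norm_smul, norm_smul, Real.norm_of_nonneg (by positivity : 0 ≤ h / (h + k)),
    Real.norm_of_nonneg (by positivity : 0 ≤ k / (h + k)),
    Real.norm_of_nonneg (by positivity : 0 ≤ h * k / (h + k))]
  gcongr
  exact _root_.norm_sub_le _ _

end Accretive

/-! ### Kobayashi's comparison of approximate solutions -/

section Kobayashi

lemma exp_neg_two_mul_le {a : ℝ} (h0 : 0 ≤ a) (h : a ≤ 1 / 2) : Real.exp (-(2 * a)) ≤ 1 - a := by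
  have h1 := Real.add_one_le_exp (2 * a)
  rw [Real.exp_neg]
  refine (inv_anti₀ (by linarith) h1).trans ?_
  rw [inv_le_iff_one_le_mul₀ (by linarith)]
  nlinarith

/-- The induction step of both comparison estimates: `b` is a supersolution of the recursion without
the factor `σ`, and the growth of `G` pays for dividing by `σ`. -/
lemma supersolution_step {a a₁ a₂ b b₁ b₂ G G₁ G₂ α β σ e : ℝ} (hα : 0 ≤ α) (hβ : 0 ≤ β)
    (hσ : 0 < σ) (he : 0 ≤ e) (hb₁ : 0 ≤ b₁) (hb₂ : 0 ≤ b₂)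
    (h : σ * a ≤ α * a₁ + β * a₂ + e) (h₁ : a₁ ≤ G₁ * b₁) (h₂ : a₂ ≤ G₂ * b₂)
    (hG₁ : G₁ ≤ σ * G) (hG₂ : G₂ ≤ σ * G) (hG : 1 ≤ σ * G) (hb : α * b₁ + β * b₂ + e ≤ b) :
    a ≤ G * b := by
  have k₁ : a₁ ≤ σ * G * b₁ := h₁.trans (mul_le_mul_of_nonneg_right hG₁ hb₁)
  have k₂ : a₂ ≤ σ * G * b₂ := h₂.trans (mul_le_mul_of_nonneg_right hG₂ hb₂)
  have k₃ : e ≤ σ * G * e := le_mul_of_one_le_left he hG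
  refine le_of_mul_le_mul_left ?_ hσ
  calc σ * a ≤ α * a₁ + β * a₂ + e := h
    _ ≤ α * (σ * G * b₁) + β * (σ * G * b₂) + σ * G * e := by gcongr
    _ = σ * G * (α * b₁ + β * b₂ + e) := by ring
    _ ≤ σ * G * b := mul_le_mul_of_nonneg_left hb (by linarith)
    _ = σ * (G * b) := by ring

/-- Averaging the square over the two neighbours produces an excess `hk(h+k)`; the linear terms
yield a gain `hk(ε+ε')`, which covers it. -/
lemma weighted_quadratic_le {h k ε ε' t s c : ℝ} (hh : 0 ≤ h) (hk : 0 ≤ k) (hε : h ≤ ε)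
    (hε' : k ≤ ε') :
    h * ((t + h - s) ^ 2 + ε * (t + h) + ε' * s + c) +
      k * ((t - (s + k)) ^ 2 + ε * t + ε' * (s + k) + c) ≤
    (h + k) * ((t + h - (s + k)) ^ 2 + ε * (t + h) + ε' * (s + k) + c) := by
  have h1 := mul_nonneg (mul_nonneg hh hk) (sub_nonneg.2 hε)
  have h2 := mul_nonneg (mul_nonneg hh hk) (sub_nonneg.2 hε')
  linear_combination h1 + h2

/-- The error terms balance exactly, since `h²/(h+k) + hk/(h+k) = h`; only the quadratic part loses
anything. -/
lemma weighted_supersolution_le {h k κ q₁ q₂ q c E F e f : ℝ} (hhk : 0 < h + k) (hκ : 0 ≤ κ)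
    (hq : h * q₁ + k * q₂ ≤ (h + k) * q) :
    h / (h + k) * (c + (E + h * e) + F + κ * q₁) + k / (h + k) * (c + E + (F + k * f) + κ * q₂) +
      h * k / (h + k) * (e + f) ≤ c + (E + h * e) + (F + k * f) + κ * q := by
  rw [div_mul_eq_mul_div, div_mul_eq_mul_div, div_mul_eq_mul_div, ← add_div, ← add_div,
    div_le_iff₀ hhk]
  linear_combination κ * hq

/-- The accumulated error of an approximate solution up to the time `t i`. -/
def accumulatedError {X : Type*} [NormedAddCommGroup X] (t : ℕ → ℝ) (θ : ℕ → X) (i : ℕ) : ℝ :=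
  ∑ l ∈ Finset.range i, (t (l + 1) - t l) * ‖θ (l + 1)‖

lemma accumulatedError_succ {X : Type*} [NormedAddCommGroup X] (t : ℕ → ℝ) (θ : ℕ → X) (i : ℕ) :
    accumulatedError t θ (i + 1) = accumulatedError t θ i + (t (i + 1) - t i) * ‖θ (i + 1)‖ :=
  Finset.sum_range_succ _ _

variable {X : Type*} [NormedAddCommGroup X] [NormedSpace ℝ X] {A : SetRel X X} {ω : ℝ}

lemma IsDiscretization.monotone {T ε : ℝ} {N : ℕ} {t : ℕ → ℝ} (h : IsDiscretization T ε N t)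
    {i j : ℕ} (hij : i ≤ j) (hj : j ≤ N) : t i ≤ t j := by
  induction j, hij using Nat.le_induction with
  | base => exact le_rfl
  | succ j _ ih => exact (ih (by omega)).trans (h.lt_succ j (by omega)).le

lemma IsDiscretization.nonneg {T ε : ℝ} {N : ℕ} {t : ℕ → ℝ} (h : IsDiscretization T ε N t)
    {i : ℕ} (hi : i ≤ N) : 0 ≤ t i :=
  h.zero.symm.le.trans (h.monotone (Nat.zero_le i) hi)

lemma IsDiscretization.le {T ε : ℝ} {N : ℕ} {t : ℕ → ℝ} (h : IsDiscretization T ε N t)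
    {i : ℕ} (hi : i ≤ N) : t i ≤ T :=
  (h.monotone hi le_rfl).trans h.last_le

variable {x x' : X} {T T' ε ε' : ℝ} {N N' : ℕ} {t s : ℕ → ℝ} {v θ u θ' : ℕ → X}

lemma IsApproxSolution.accumulatedError_nonneg (hv : IsApproxSolution A x T ε N t v θ)
    {i : ℕ} (hi : i ≤ N) : 0 ≤ accumulatedError t θ i :=
  Finset.sum_nonneg fun l hl => mul_nonneg
    (sub_nonneg.2 (hv.discretization.lt_succ l (by have := Finset.mem_range.1 hl; omega)).le)
    (norm_nonneg _)

lemma IsApproxSolution.accumulatedError_le (hv : IsApproxSolution A x T ε N t v θ)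
    {i : ℕ} (hi : i ≤ N) : accumulatedError t θ i ≤ ε := by
  refine le_trans ?_ hv.error
  refine Finset.sum_le_sum_of_subset_of_nonneg (Finset.range_mono hi) fun l hl _ => mul_nonneg
    (sub_nonneg.2 (hv.discretization.lt_succ l (Finset.mem_range.1 hl)).le) (norm_nonneg _)

/-- Iterates `norm_step_sub_le`. It supplies the boundary values `i = 0` and `j = 0` of the
two-index induction below. -/
lemma IsApproxSolution.norm_sub_point_le (hA : IsOmegaAccretive ω A) (hω : 0 ≤ ω)
    (hv : IsApproxSolution A x T ε N t v θ) (hε : ω * ε ≤ 1 / 2) {z w : X} (hz : (z, w) ∈ A)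
    {i : ℕ} (hi : i ≤ N) :
    ‖v i - z‖ ≤ Real.exp (2 * ω * t i) * (‖v 0 - z‖ + accumulatedError t θ i + t i * ‖w‖) := by
  induction i with
  | zero => simp [hv.discretization.zero, accumulatedError]
  | succ i ih =>
    have hD := hv.discretization
    obtain ⟨y, hy, hθ⟩ := hv.step i (by omega)
    have hh : 0 < t (i + 1) - t i := sub_pos.2 (hD.lt_succ i (by omega))
    have hhε := hD.mesh_le i (by omega)
    have hti := hD.nonneg (show i ≤ N by omega)
    have hEi := hv.accumulatedError_nonneg (show i ≤ N by omega)
    have hhω : ω * (t (i + 1) - t i) ≤ 1 / 2 := (mul_le_mul_of_nonneg_left hhε hω).trans hε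
    have hhω0 : 0 ≤ ω * (t (i + 1) - t i) := mul_nonneg hω hh.le
    have key := hA.norm_step_sub_le hh (by linarith) hy hθ hz
    have hexp := exp_neg_two_mul_le hhω0 hhω
    rw [accumulatedError_succ]
    set h := t (i + 1) - t i with hdef
    have ht : t (i + 1) = t i + h := by rw [hdef]; ring
    have hG : Real.exp (2 * ω * t i) ≤ (1 - ω * h) * Real.exp (2 * ω * t (i + 1)) := by
      have : Real.exp (2 * ω * t i) = Real.exp (-(2 * (ω * h))) * Real.exp (2 * ω * t (i + 1)) := by
        rw [← Real.exp_add, ht]; congr 1; ring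
      rw [this]
      exact mul_le_mul_of_nonneg_right hexp (Real.exp_nonneg _)
    refine supersolution_step (α := 1) (β := 0) (a₂ := 0) (b₂ := 0) (G₂ := 0) (σ := 1 - ω * h)
      (e := h * ‖θ (i + 1)‖ + h * ‖w‖) zero_le_one le_rfl (by linarith) (by positivity)
      (b₁ := ‖v 0 - z‖ + accumulatedError t θ i + t i * ‖w‖) (by positivity) le_rfl ?_
      (ih (by omega)) (by simp) hG
      (mul_nonneg (by linarith) (Real.exp_nonneg _)) ?_ ?_
    · rw [mul_comm ω h]; linarith
    · refine le_trans ?_ hG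
      exact Real.one_le_exp (by positivity)
    · rw [ht]; linarith

/-- A discrete comparison estimate in the manner of Kobayashi. -/
theorem IsApproxSolution.norm_sub_le (hA : IsOmegaAccretive ω A) (hω : 0 ≤ ω)
    (hv : IsApproxSolution A x T ε N t v θ) (hε : ω * ε ≤ 1 / 2)
    (hu : IsApproxSolution A x' T' ε' N' s u θ') (hε' : ω * ε' ≤ 1 / 2)
    {z w : X} (hz : (z, w) ∈ A) {η : ℝ} (hη : 0 < η) {i j : ℕ} (hi : i ≤ N) (hj : j ≤ N') :
    ‖v i - u j‖ ≤ Real.exp (2 * ω * (t i + s j)) * (‖v 0 - z‖ + ‖u 0 - z‖ +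
      accumulatedError t θ i + accumulatedError s θ' j +
      ‖w‖ / (2 * η) * ((t i - s j) ^ 2 + ε * t i + ε' * s j + η ^ 2)) := by
  have hD := hv.discretization
  have hD' := hu.discretization
  have hεpos : 0 < ε := (sub_pos.2 (hD.lt_succ 0 hD.one_le)).trans_le (hD.mesh_le 0 hD.one_le)
  have hεpos' : 0 < ε' :=
    (sub_pos.2 (hD'.lt_succ 0 hD'.one_le)).trans_le (hD'.mesh_le 0 hD'.one_le)
  -- From `2rη ≤ r² + η²`: a quadratic majorant of the linear boundary data, with `η` left free.
  have hquad : ∀ r q : ℝ, 0 ≤ q → r * ‖w‖ ≤ ‖w‖ / (2 * η) * (r ^ 2 + q + η ^ 2) := by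
    intro r q hq
    rw [div_mul_eq_mul_div, le_div_iff₀ (by positivity)]
    nlinarith [mul_nonneg (norm_nonneg w) (add_nonneg (sq_nonneg (r - η)) hq)]
  induction i generalizing j with
  | zero =>
    have h1 := hu.norm_sub_point_le hA hω hε' hz hj
    have hs := hD'.nonneg hj
    have hF := hu.accumulatedError_nonneg hj
    have hq := hquad (s j) (ε' * s j) (by positivity)
    have hG : 1 ≤ Real.exp (2 * ω * s j) := Real.one_le_exp (by positivity)
    rw [hD.zero]
    simp only [accumulatedError, Finset.range_zero, Finset.sum_empty, zero_add, mul_zero, add_zero,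
      zero_sub, neg_sq]
    rw [norm_sub_rev]
    calc ‖u j - v 0‖ ≤ ‖u j - z‖ + ‖v 0 - z‖ := by
          rw [norm_sub_rev (v 0)]; exact norm_sub_le_norm_sub_add_norm_sub _ _ _
      _ ≤ Real.exp (2 * ω * s j) * (‖u 0 - z‖ + accumulatedError s θ' j + s j * ‖w‖) +
          Real.exp (2 * ω * s j) * ‖v 0 - z‖ :=
        add_le_add h1 (le_mul_of_one_le_left (norm_nonneg _) hG)
      _ = Real.exp (2 * ω * s j) * (‖v 0 - z‖ + ‖u 0 - z‖ + accumulatedError s θ' j +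
          s j * ‖w‖) := by ring
      _ ≤ _ := mul_le_mul_of_nonneg_left (by unfold accumulatedError; linarith) (Real.exp_nonneg _)
  | succ i ih =>
    have hti := hD.nonneg (show i ≤ N by omega)
    have hti1 := hD.nonneg hi
    have hEi := hv.accumulatedError_nonneg (show i ≤ N by omega)
    have hEi1 := hv.accumulatedError_nonneg hi
    induction j with
    | zero =>
      have h1 := hv.norm_sub_point_le hA hω hε hz hi
      have hq := hquad (t (i + 1)) (ε * t (i + 1)) (by positivity)
      have hG : 1 ≤ Real.exp (2 * ω * t (i + 1)) := Real.one_le_exp (by positivity)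
      have e0 : accumulatedError s θ' 0 = 0 := by simp [accumulatedError]
      rw [hD'.zero, e0]
      simp only [mul_zero, add_zero, sub_zero]
      calc ‖v (i + 1) - u 0‖ ≤ ‖v (i + 1) - z‖ + ‖u 0 - z‖ := by
            rw [norm_sub_rev (u 0)]; exact norm_sub_le_norm_sub_add_norm_sub _ _ _
        _ ≤ Real.exp (2 * ω * t (i + 1)) *
              (‖v 0 - z‖ + accumulatedError t θ (i + 1) + t (i + 1) * ‖w‖) +
            Real.exp (2 * ω * t (i + 1)) * ‖u 0 - z‖ :=
          add_le_add h1 (le_mul_of_one_le_left (norm_nonneg _) hG)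
        _ = Real.exp (2 * ω * t (i + 1)) * (‖v 0 - z‖ + ‖u 0 - z‖ +
            accumulatedError t θ (i + 1) + t (i + 1) * ‖w‖) := by ring
        _ ≤ _ := mul_le_mul_of_nonneg_left (by linarith) (Real.exp_nonneg _)
    | succ j ihj =>
      have h₂ := ih (show i ≤ N by omega) hj
      have h₁ := ihj (by omega)
      have hsj := hD'.nonneg (show j ≤ N' by omega)
      have hsj1 := hD'.nonneg hj
      have hFj := hu.accumulatedError_nonneg (show j ≤ N' by omega)
      have hFj1 := hu.accumulatedError_nonneg hj
      obtain ⟨y, hy, hθ⟩ := hv.step i (by omega)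
      obtain ⟨y', hy', hθ'⟩ := hu.step j (by omega)
      have hh : 0 < t (i + 1) - t i := sub_pos.2 (hD.lt_succ i (by omega))
      have hk : 0 < s (j + 1) - s j := sub_pos.2 (hD'.lt_succ j (by omega))
      have hhε := hD.mesh_le i (by omega)
      have hkε := hD'.mesh_le j (by omega)
      rw [accumulatedError_succ] at h₁ h₂ ⊢
      rw [accumulatedError_succ s]
      set h := t (i + 1) - t i with hdef
      set k := s (j + 1) - s j with kdef
      have ht : t (i + 1) = t i + h := by rw [hdef]; ring
      have hs : s (j + 1) = s j + k := by rw [kdef]; ring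
      have hhω : ω * h ≤ 1 / 2 := (mul_le_mul_of_nonneg_left hhε hω).trans hε
      have hkω : ω * k ≤ 1 / 2 := (mul_le_mul_of_nonneg_left hkε hω).trans hε'
      have hhω0 : 0 ≤ ω * h := mul_nonneg hω hh.le
      have hkω0 : 0 ≤ ω * k := mul_nonneg hω hk.le
      -- As `hk/(h+k) ≤ min h k`, stepping back in either time gains a factor `exp(-2ωh)` or
      -- `exp(-2ωk)` that is at most `1 - ω hk/(h+k)`.
      have hlh : h * k / (h + k) ≤ h := by rw [div_le_iff₀ (by positivity)]; nlinarith
      have hlk : h * k / (h + k) ≤ k := by rw [div_le_iff₀ (by positivity)]; nlinarith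
      have hlhω : h * k / (h + k) * ω ≤ ω * h := by
        rw [mul_comm ω]; exact mul_le_mul_of_nonneg_right hlh hω
      have hlkω : h * k / (h + k) * ω ≤ ω * k := by
        rw [mul_comm ω]; exact mul_le_mul_of_nonneg_right hlk hω
      have key := hA.norm_step_sub_step_le hh hk (by linarith) hy hθ hy' hθ'
      have hG₁ : Real.exp (2 * ω * (t (i + 1) + s j)) ≤
          (1 - h * k / (h + k) * ω) * Real.exp (2 * ω * (t (i + 1) + s (j + 1))) := by
        have : Real.exp (2 * ω * (t (i + 1) + s j)) = Real.exp (-(2 * (ω * k))) *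
            Real.exp (2 * ω * (t (i + 1) + s (j + 1))) := by
          rw [← Real.exp_add, hs]; congr 1; ring
        rw [this]
        refine mul_le_mul_of_nonneg_right ?_ (Real.exp_nonneg _)
        exact (exp_neg_two_mul_le hkω0 hkω).trans (by linarith)
      have hG₂ : Real.exp (2 * ω * (t i + s (j + 1))) ≤
          (1 - h * k / (h + k) * ω) * Real.exp (2 * ω * (t (i + 1) + s (j + 1))) := by
        have : Real.exp (2 * ω * (t i + s (j + 1))) = Real.exp (-(2 * (ω * h))) *
            Real.exp (2 * ω * (t (i + 1) + s (j + 1))) := by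
          rw [← Real.exp_add, ht]; congr 1; ring
        rw [this]
        refine mul_le_mul_of_nonneg_right ?_ (Real.exp_nonneg _)
        exact (exp_neg_two_mul_le hhω0 hhω).trans (by linarith)
      refine supersolution_step (by positivity) (by positivity) (by linarith) (by positivity)
        (by positivity) (by positivity) key h₁ h₂ hG₁ hG₂
        (le_trans (Real.one_le_exp (by positivity)) hG₁) ?_
      refine weighted_supersolution_le (by positivity) (by positivity) ?_
      rw [ht, hs]
      exact weighted_quadratic_le hh.le hk.le hhε hkε

/-- The comparison estimate for two approximate solutions with the same initial value, in terms of
a single parameter `η` that controls meshes, errors and the time difference. -/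
theorem IsApproxSolution.norm_sub_le_of_le (hA : IsOmegaAccretive ω A) (hω : 0 ≤ ω)
    {η S r W : ℝ} (hη : 0 < η) (hη1 : η ≤ 1) (hηω : ω * η ^ 2 ≤ 1 / 2)
    (hv : IsApproxSolution A x T ε N t v θ) (hε : ε ≤ η ^ 2) (hT : T ≤ S)
    (hu : IsApproxSolution A x T' ε' N' s u θ') (hε' : ε' ≤ η ^ 2) (hT' : T' ≤ S)
    {z w : X} (hz : (z, w) ∈ A) (hr : ‖x - z‖ ≤ r) (hW : ‖w‖ ≤ W) {i j : ℕ} (hi : i ≤ N)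
    (hj : j ≤ N') (hij : |t i - s j| ≤ η ^ 2) :
    ‖v i - u j‖ ≤ Real.exp (4 * ω * S) * (2 * r + 4 * η ^ 2 + W * (1 + S) * η) := by
  have hD := hv.discretization
  have hD' := hu.discretization
  have h := hv.norm_sub_le hA hω ((mul_le_mul_of_nonneg_left hε hω).trans hηω) hu
    ((mul_le_mul_of_nonneg_left hε' hω).trans hηω) hz hη hi hj
  have hti := hD.nonneg hi
  have hsj := hD'.nonneg hj
  have hti' := (hD.le hi).trans hT
  have hsj' := (hD'.le hj).trans hT'
  have hE := hv.accumulatedError_le hi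
  have hF := hu.accumulatedError_le hj
  have hE0 := hv.accumulatedError_nonneg hi
  have hF0 := hu.accumulatedError_nonneg hj
  have hv0 : ‖v 0 - z‖ ≤ η ^ 2 + r :=
    (norm_sub_le_norm_sub_add_norm_sub _ x _).trans (add_le_add (hv.initial.trans hε) hr)
  have hu0 : ‖u 0 - z‖ ≤ η ^ 2 + r :=
    (norm_sub_le_norm_sub_add_norm_sub _ x _).trans (add_le_add (hu.initial.trans hε') hr)
  have hS : 0 ≤ S := hti.trans hti'
  have hε0 : 0 ≤ ε := (norm_nonneg _).trans hv.initial
  have hε0' : 0 ≤ ε' := (norm_nonneg _).trans hu.initial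
  have hη2 : η ^ 2 ≤ 1 := pow_le_one₀ hη.le hη1
  have hd : (t i - s j) ^ 2 ≤ η ^ 2 := by
    rw [← sq_abs]
    nlinarith [abs_nonneg (t i - s j)]
  -- All four terms are of order `η²`, so division by `2η` leaves order `η`.
  have hsum : (t i - s j) ^ 2 + ε * t i + ε' * s j + η ^ 2 ≤ 2 * (1 + S) * η ^ 2 := by
    have h1 : ε * t i ≤ η ^ 2 * S := mul_le_mul hε hti' hti (sq_nonneg _)
    have h2 : ε' * s j ≤ η ^ 2 * S := mul_le_mul hε' hsj' hsj (sq_nonneg _)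
    linarith
  have hw : ‖w‖ / (2 * η) * ((t i - s j) ^ 2 + ε * t i + ε' * s j + η ^ 2) ≤
      W * (1 + S) * η := by
    have hW0 : 0 ≤ W := (norm_nonneg w).trans hW
    calc _ ≤ W / (2 * η) * (2 * (1 + S) * η ^ 2) := by gcongr
      _ = _ := by field_simp
  refine h.trans (mul_le_mul (Real.exp_le_exp.2 ?_) (by linarith) ?_ (Real.exp_nonneg _))
  · nlinarith
  · positivity

end Kobayashi

/-! ### Existence and uniqueness of mild solutions, and their Euler approximation -/

section MildSolutions

lemma exists_small_parameter (C W K ω : ℝ) {r ε : ℝ} (h : C * (2 * r) < ε) :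
    ∃ η : ℝ, 0 < η ∧ η ≤ 1 ∧ ω * η ^ 2 ≤ 1 / 2 ∧
      η ^ 2 + C * (2 * r + 4 * η ^ 2 + W * K * η) < ε := by
  have h1 : Tendsto (fun η : ℝ => η ^ 2 + C * (2 * r + 4 * η ^ 2 + W * K * η)) (𝓝[>] 0)
      (𝓝 (C * (2 * r))) := by
    have : Continuous fun η : ℝ => η ^ 2 + C * (2 * r + 4 * η ^ 2 + W * K * η) := by fun_prop
    simpa using (this.tendsto 0).mono_left nhdsWithin_le_nhds
  have h2 : Tendsto (fun η : ℝ => ω * η ^ 2) (𝓝[>] 0) (𝓝 0) := by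
    have : Continuous fun η : ℝ => ω * η ^ 2 := by fun_prop
    simpa using (this.tendsto 0).mono_left nhdsWithin_le_nhds
  have h3 : ∀ᶠ η : ℝ in 𝓝[>] 0, η ∈ Ioc (0 : ℝ) 1 := Ioc_mem_nhdsGT one_pos
  obtain ⟨η, ha, hb, hc⟩ := (h1.eventually_lt_const h).and
    ((h2.eventually_le_const (by norm_num : (0 : ℝ) < 1 / 2)).and h3) |>.exists
  exact ⟨η, hc.1, hc.2, hb, ha⟩

lemma exists_seq_of_forall_exists {α : Type*} {C : α → Prop} {R : α → α → Prop}
    (h : ∀ a, C a → ∃ b, C b ∧ R a b) {a : α} (ha : C a) :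
    ∃ f : ℕ → α, f 0 = a ∧ ∀ n, R (f n) (f (n + 1)) := by
  choose g hg using h
  let F : ℕ → {a // C a} := fun n => Nat.rec ⟨a, ha⟩ (fun _ b => ⟨g b.1 b.2, (hg b.1 b.2).1⟩) n
  exact ⟨fun n => (F n).1, rfl, fun n => (hg (F n).1 (F n).2).2⟩

lemma abs_natCeil_mul_sub_le {s h : ℝ} (hs : 0 ≤ s) (hh : 0 < h) : |⌈s / h⌉₊ * h - s| ≤ h := by
  have h1 : s ≤ ⌈s / h⌉₊ * h := (div_le_iff₀ hh).1 (Nat.le_ceil _)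
  have h2 : (⌈s / h⌉₊ : ℝ) * h ≤ s + h := by
    have := mul_le_mul_of_nonneg_right (Nat.ceil_lt_add_one (div_nonneg hs hh.le)).le hh.le
    rwa [add_mul, div_mul_cancel₀ _ hh.ne', one_mul] at this
  rw [abs_of_nonneg (by linarith)]
  linarith

variable {X : Type*} [NormedAddCommGroup X]

lemma exists_mem_norm_sub_lt {A : SetRel X X} {x : X} (hx : x ∈ closure A.dom) {r : ℝ} (hr : 0 < r) :
    ∃ z w : X, (z, w) ∈ A ∧ ‖x - z‖ < r := by
  obtain ⟨z, ⟨w, hw⟩, hz⟩ := Metric.mem_closure_iff.1 hx r hr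
  exact ⟨z, w, hw, by rwa [← dist_eq_norm]⟩

/-- At every time, an approximate solution near `u` has a value near that of `u`. -/
lemma IsNearInterpolation.exists_index {u : ℝ → X} {T ε ε' : ℝ} {N : ℕ} {t : ℕ → ℝ} {v : ℕ → X}
    (hu : IsNearInterpolation u T ε' N t v) (hD : IsDiscretization T ε N t) {s : ℝ}
    (hs : s ∈ Icc 0 T) : ∃ i ≤ N, |t i - s| ≤ ε ∧ ‖u s - v i‖ ≤ ε' := by
  have hε : 0 ≤ ε := (sub_nonneg.2 (hD.lt_succ 0 hD.one_le).le).trans (hD.mesh_le 0 hD.one_le)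
  rcases hs.1.eq_or_lt with rfl | h0
  · exact ⟨0, Nat.zero_le _, by simpa [hD.zero] using hε, hu.1⟩
  rcases lt_or_ge (t N) s with hN | hN
  · refine ⟨N, le_rfl, ?_, hu.2.2 s ⟨hN, hs.2⟩⟩
    rw [abs_le]
    constructor <;> linarith [hD.lt_last, hs.2]
  classical
  have hex : ∃ i, s ≤ t i := ⟨N, hN⟩
  have hle : Nat.find hex ≤ N := Nat.find_min' hex hN
  obtain ⟨k, hk⟩ : ∃ k, Nat.find hex = k + 1 := by
    refine Nat.exists_eq_succ_of_ne_zero fun h => ?_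
    have := Nat.find_spec hex
    rw [h, hD.zero] at this
    exact this.not_gt h0
  have h1 : t k < s := not_le.1 (Nat.find_min hex (by omega))
  have h2 : s ≤ t (k + 1) := hk ▸ Nat.find_spec hex
  refine ⟨k + 1, hk ▸ hle, ?_, hu.2.1 k (by omega) s ⟨h1, h2⟩⟩
  have := hD.mesh_le k (by omega)
  rw [abs_le]
  constructor <;> linarith

variable [NormedSpace ℝ X] {A : SetRel X X} {ω : ℝ}

/-- Iterated resolvents are approximate solutions with vanishing error. -/
lemma isApproxSolution_of_resolvent {x : X} {h ε : ℝ} (hh : 0 < h) (hε : h ≤ ε) {N : ℕ}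
    (hN : 1 ≤ N) {v : ℕ → X} (hv0 : v 0 = x) (hv : ∀ i, (v i, v (i + 1)) ∈ opResolvent h A) :
    IsApproxSolution A x (N * h) ε N (fun i => i * h) v 0 where
  discretization :=
    { one_le := hN
      zero := by simp
      lt_succ := fun i _ => by push_cast; linarith
      mesh_le := fun i _ => by push_cast; linarith
      lt_last := by linarith
      last_le := le_rfl }
  theta_zero := rfl
  initial := by simpa [hv0] using hh.le.trans hε
  step := fun i _ => by
    refine ⟨_, (mem_opResolvent_iff hh.ne').1 (hv i), ?_⟩
    have : ((i + 1 : ℕ) : ℝ) * h - i * h = h := by push_cast; ring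
    rw [this, ← smul_add]
    simp
  error := by simpa using hh.le.trans hε

/-- First `z` is taken near `x`, which fixes `‖w‖`; then `η` is made small. Thus `ρ` depends on no
scheme, which serves both uniqueness and the Cauchy property. -/
lemma exists_modulus (hA : IsOmegaAccretive ω A) (hω : 0 ≤ ω) {x : X} (hx : x ∈ closure A.dom)
    (S : ℝ) {ε₀ : ℝ} (hε₀ : 0 < ε₀) :
    ∃ ρ : ℝ, 0 < ρ ∧ ρ ≤ 1 ∧ ∀ {T T' ε ε' : ℝ} {N N' : ℕ} {t s : ℕ → ℝ} {v θ u θ' : ℕ → X},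
      IsApproxSolution A x T ε N t v θ → ε ≤ ρ → T ≤ S →
      IsApproxSolution A x T' ε' N' s u θ' → ε' ≤ ρ → T' ≤ S →
      ∀ {i j : ℕ}, i ≤ N → j ≤ N' → |t i - s j| ≤ ρ → ‖v i - u j‖ ≤ ε₀ := by
  have hC := Real.exp_pos (4 * ω * S)
  obtain ⟨z, w, hz, hxz⟩ := exists_mem_norm_sub_lt hx
    (show 0 < ε₀ / (2 * Real.exp (4 * ω * S)) by positivity)
  have hr : Real.exp (4 * ω * S) * (2 * ‖x - z‖) < ε₀ := by
    rw [lt_div_iff₀ (by positivity)] at hxz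
    linarith
  obtain ⟨η, hη, hη1, hηω, hlt⟩ := exists_small_parameter _ ‖w‖ (1 + S) ω hr
  refine ⟨η ^ 2, by positivity, pow_le_one₀ hη.le hη1, ?_⟩
  intro T T' ε ε' N N' t s v θ u θ' hv hε hT hu hε' hT' i j hi hj hij
  exact (hv.norm_sub_le_of_le hA hω hη hη1 hηω hε hT hu hε' hT' hz le_rfl le_rfl hi hj hij).trans
    (by linarith [sq_nonneg η])

theorem IsMildSolution.eqOn (hA : IsOmegaAccretive ω A) (hω : 0 ≤ ω) {x : X}
    (hx : x ∈ closure A.dom) {u w : ℝ → X} (hu : IsMildSolution A x u)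
    (hw : IsMildSolution A x w) : EqOn w u (Ici 0) := by
  intro s hs
  have hs : 0 ≤ s := hs
  refine eq_of_forall_dist_le fun ε₀ hε₀ => ?_
  -- The horizon `s + 1` is positive even when `s = 0`.
  obtain ⟨ρ, hρ, -, H⟩ := exists_modulus hA hω hx (s + 1) (show 0 < ε₀ / 2 by positivity)
  have he : 0 < min (ρ / 2) (ε₀ / 4) := by positivity
  have he1 := min_le_left (ρ / 2) (ε₀ / 4)
  have he2 := min_le_right (ρ / 2) (ε₀ / 4)
  obtain ⟨N, t, v, θ, hv, hn⟩ := (hu (s + 1) (by positivity)).2.2 _ he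
  obtain ⟨N', t', v', θ', hv', hn'⟩ := (hw (s + 1) (by positivity)).2.2 _ he
  obtain ⟨i, hi, hti, hui⟩ := hn.exists_index hv.discretization (s := s) ⟨hs, by linarith⟩
  obtain ⟨j, hj, htj, hwj⟩ := hn'.exists_index hv'.discretization (s := s) ⟨hs, by linarith⟩
  have key := H hv' (by linarith) le_rfl hv (by linarith) le_rfl hj hi (by
    have := abs_sub_le (t' j) s (t i)
    rw [abs_sub_comm s] at this
    linarith)
  rw [dist_eq_norm]
  have e : w s - u s = (w s - v' j) + (v' j - v i) + (v i - u s) := by abel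
  rw [e]
  refine norm_add₃_le.trans ?_
  rw [norm_sub_rev (v i)]
  linarith

/-- The limit of the implicit Euler schemes with initial value `x`. -/
lemma exists_tendsto_euler [CompleteSpace X] (hA : IsOmegaAccretive ω A) (hω : 0 ≤ ω) {x : X}
    (hx : x ∈ closure A.dom) {δ : ℝ} (hδ : 0 < δ) {V : ℝ → ℕ → X}
    (hV : ∀ h ∈ Ioo 0 δ, V h 0 = x ∧ ∀ i, (V h i, V h (i + 1)) ∈ opResolvent h A) :
    ∃ u : ℝ → X, ∀ S ε₀ : ℝ, 0 < ε₀ → ∃ ρ : ℝ, 0 < ρ ∧ ρ < δ ∧ ∀ h ∈ Ioo 0 ρ, ∀ i : ℕ,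
      i * h ≤ S + 1 → ∀ s ∈ Icc 0 S, |i * h - s| ≤ ρ → ‖V h i - u s‖ ≤ ε₀ := by
  have H1 : ∀ S ε₀ : ℝ, 0 < ε₀ → ∃ ρ : ℝ, 0 < ρ ∧ ρ < δ ∧ ρ ≤ 1 ∧ ∀ h ∈ Ioo 0 ρ, ∀ h' ∈ Ioo 0 ρ,
      ∀ i j : ℕ, i * h ≤ S + 1 → j * h' ≤ S + 1 → |i * h - j * h'| ≤ ρ →
      ‖V h i - V h' j‖ ≤ ε₀ := by
    intro S ε₀ hε₀
    -- A discretization has at least one step, so index `i` is viewed in a scheme of `i + 1` steps,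
    -- which ends by `S + 2` because `h ≤ 1`.
    obtain ⟨ρ, hρ, hρ1, H⟩ := exists_modulus hA hω hx (S + 2) hε₀
    have hm1 := min_le_left ρ (δ / 2)
    have hm2 := min_le_right ρ (δ / 2)
    refine ⟨min ρ (δ / 2), by positivity, by linarith, by linarith, ?_⟩
    intro h hh h' hh' i j hi hj hij
    have hhb := hh.2
    have hhb' := hh'.2
    obtain ⟨h0, h1⟩ := hV h ⟨hh.1, by linarith⟩
    obtain ⟨h0', h1'⟩ := hV h' ⟨hh'.1, by linarith⟩
    exact H (isApproxSolution_of_resolvent (N := i + 1) hh.1 le_rfl (by omega) h0 h1) (by linarith)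
      (by push_cast; linarith)
      (isApproxSolution_of_resolvent (N := j + 1) hh'.1 le_rfl (by omega) h0' h1') (by linarith)
      (by push_cast; linarith) (Nat.le_succ i) (Nat.le_succ j) (hij.trans hm1)
  -- The limit is defined along one sequence of steps; `H1` then compares every small step with it.
  let η : ℕ → ℝ := fun n => δ / (n + 1)
  have hη0 : ∀ n, 0 < η n := fun n => by positivity
  have hηlim : Tendsto η atTop (𝓝 0) := by
    simpa [η, div_eq_mul_inv] using (tendsto_one_div_add_atTop_nhds_zero_nat (𝕜 := ℝ)).const_mul δ
  have H2 : ∀ s : ℝ, ∃ y : X, 0 ≤ s →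
      Tendsto (fun n => V (η n) ⌈s / η n⌉₊) atTop (𝓝 y) := by
    intro s
    by_cases hs : 0 ≤ s
    · suffices h : CauchySeq (fun n => V (η n) ⌈s / η n⌉₊) by
        obtain ⟨y, hy⟩ := cauchySeq_tendsto_of_complete h
        exact ⟨y, fun _ => hy⟩
      rw [Metric.cauchySeq_iff]
      intro ε₀ hε₀
      obtain ⟨ρ, hρ, -, hρ1, H⟩ := H1 s (ε₀ / 2) (by positivity)
      obtain ⟨n₀, hn₀⟩ := eventually_atTop.1
        (hηlim.eventually_lt_const (show 0 < ρ / 2 by positivity))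
      refine ⟨n₀, fun m hm n hn => ?_⟩
      have hm' := hn₀ m hm
      have hn' := hn₀ n hn
      have cm := abs_natCeil_mul_sub_le hs (hη0 m)
      have cn := abs_natCeil_mul_sub_le hs (hη0 n)
      rw [dist_eq_norm]
      refine (H _ ⟨hη0 m, by linarith⟩ _ ⟨hη0 n, by linarith⟩ _ _ ?_ ?_ ?_).trans_lt (by linarith)
      · linarith [(abs_le.1 cm).2]
      · linarith [(abs_le.1 cn).2]
      · rw [abs_le] at *
        constructor <;> linarith
    · exact ⟨0, fun h => absurd h hs⟩
  choose u hu using H2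
  refine ⟨u, fun S ε₀ hε₀ => ?_⟩
  obtain ⟨ρ, hρ, hρδ, hρ1, H⟩ := H1 S ε₀ hε₀
  refine ⟨ρ / 2, by positivity, by linarith, ?_⟩
  intro h hh i hi s hs his
  have hlim := ((hu s hs.1).const_sub (V h i)).norm
  refine le_of_tendsto hlim ?_
  filter_upwards [hηlim.eventually_lt_const (show 0 < ρ / 2 by positivity)] with n hn
  have cn := abs_natCeil_mul_sub_le hs.1 (hη0 n)
  refine H _ ⟨hh.1, by linarith [hh.2]⟩ _ ⟨hη0 n, by linarith⟩ _ _ hi ?_ ?_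
  · linarith [(abs_le.1 cn).2, hs.2]
  · rw [abs_le] at *
    constructor <;> linarith

/-- The generation theorem of Crandall and Liggett. -/
theorem exists_isMildSolution [CompleteSpace X] (hA : IsOmegaAccretive ω A) (hω : 0 ≤ ω)
    (hr : RangeCondition A) {x : X} (hx : x ∈ closure A.dom) :
    ∃ u : ℝ → X, IsMildSolution A x u := by
  obtain ⟨δ, hδ, hδr⟩ := hr
  have hE : ∀ h : ℝ, ∃ v : ℕ → X, h ∈ Ioo 0 δ →
      v 0 = x ∧ ∀ i, (v i, v (i + 1)) ∈ opResolvent h A := by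
    intro h
    by_cases hh : h ∈ Ioo 0 δ
    -- Resolvent values lie in `D(A)`, so the range condition can be applied again.
    · obtain ⟨f, hf⟩ := exists_seq_of_forall_exists (C := fun z => z ∈ closure A.dom)
        (R := fun z p => (z, p) ∈ opResolvent h A) (fun z hz => by
          obtain ⟨p, hp⟩ := hδr h hh hz
          have hp' : (z, p) ∈ opResolvent h A := hp
          exact ⟨p, subset_closure ⟨_, (mem_opResolvent_iff hh.1.ne').1 hp'⟩, hp'⟩) hx
      exact ⟨f, fun _ => hf⟩
    · exact ⟨fun _ => x, fun h => absurd h hh⟩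
  choose V hV using hE
  obtain ⟨u, hu⟩ := exists_tendsto_euler hA hω hx hδ hV
  refine ⟨u, fun T hT => ⟨?_, ?_, ?_⟩⟩
  · rw [Metric.continuousOn_iff]
    intro s hs ε₀ hε₀
    obtain ⟨ρ, hρ, hρδ, H⟩ := hu T (ε₀ / 3) (by positivity)
    have hm1 := min_le_left (ρ / 2) 1
    have hm2 := min_le_right (ρ / 2) 1
    set h := min (ρ / 2) 1
    have hh : 0 < h := by positivity
    refine ⟨ρ / 2, by positivity, fun s' hs' hss' => ?_⟩
    rw [Real.dist_eq] at hss'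
    have c := abs_natCeil_mul_sub_le hs.1 hh
    have hle : (⌈s / h⌉₊ : ℝ) * h ≤ T + 1 := by linarith [(abs_le.1 c).2, hs.2]
    have k1 := H h ⟨hh, by linarith⟩ _ hle s hs (by linarith)
    have k2 := H h ⟨hh, by linarith⟩ _ hle s' hs' (by
      have := abs_sub_le (⌈s / h⌉₊ * h) s s'
      rw [abs_sub_comm s] at this
      linarith)
    rw [norm_sub_rev] at k2
    have := norm_sub_le_norm_sub_add_norm_sub (u s') (V h ⌈s / h⌉₊) (u s)
    rw [dist_eq_norm]
    linarith
  · refine eq_of_forall_dist_le fun ε₀ hε₀ => ?_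
    obtain ⟨ρ, hρ, hρδ, H⟩ := hu 0 ε₀ hε₀
    have := H (ρ / 2) ⟨by positivity, by linarith⟩ 0 (by simp) 0 ⟨le_rfl, le_rfl⟩
      (by simpa using hρ.le)
    rwa [(hV (ρ / 2) ⟨by positivity, by linarith⟩).1, norm_sub_rev, ← dist_eq_norm] at this
  · intro ε hε
    obtain ⟨ρ, hρ, hρδ, H⟩ := hu T ε hε
    -- The step `T / m` makes the grid end at `T`, so the last interval `(t_N, T]` is empty.
    obtain ⟨m, hm⟩ := exists_nat_gt (T / min ρ ε)
    have hmin : 0 < min ρ ε := by positivity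
    have hm0 : (0 : ℝ) < m := (div_pos hT hmin).trans hm
    have hlt : T / m < min ρ ε := by
      rw [div_lt_iff₀ hmin] at hm
      rw [div_lt_iff₀ hm0]
      linarith
    have hh : 0 < T / m := by positivity
    have hhρ := hlt.trans_le (min_le_left _ _)
    have hhε := hlt.trans_le (min_le_right _ _)
    obtain ⟨h0, h1⟩ := hV (T / m) ⟨hh, by linarith⟩
    have hm1 : 1 ≤ m := by exact_mod_cast hm0
    have hmT : (m : ℝ) * (T / m) = T := by field_simp
    have happ := isApproxSolution_of_resolvent hh hhε.le hm1 h0 h1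
    have hnear : ∀ i ≤ m, ∀ s ∈ Icc 0 T, |i * (T / m) - s| ≤ ρ → ‖u s - V (T / m) i‖ ≤ ε := by
      intro i hi s hs hd
      rw [norm_sub_rev]
      have := happ.discretization.le hi
      exact H _ ⟨hh, hhρ⟩ i (by linarith) s hs hd
    refine ⟨m, fun i => i * (T / m), V (T / m), 0, ?_, ?_, ?_, ?_⟩
    · rw [hmT] at happ
      exact happ
    · exact hnear 0 (Nat.zero_le _) 0 ⟨le_rfl, hT.le⟩ (by simpa using hρ.le)
    · intro i hi s hs
      have hi0 := happ.discretization.nonneg (show i ≤ m by omega)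
      have hi1 := happ.discretization.le (show i + 1 ≤ m by omega)
      simp only [mem_Ioc] at hs
      rw [hmT] at hi1
      refine hnear (i + 1) hi s ⟨by linarith [hs.1], by linarith [hs.2]⟩ ?_
      have : ((i + 1 : ℕ) : ℝ) * (T / m) = i * (T / m) + T / m := by push_cast; ring
      rw [abs_le]
      constructor <;> linarith [hs.1, hs.2]
    · intro s hs
      simp only [mem_Ioc, hmT] at hs
      exact absurd hs.1 hs.2.not_gt

theorem closure_dom_subset_semigroupDomain [CompleteSpace X] (hA : IsOmegaAccretive ω A)
    (hω : 0 ≤ ω) (hr : RangeCondition A) : closure A.dom ⊆ semigroupDomain A := fun _ hx => by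
  obtain ⟨u, hu⟩ := exists_isMildSolution hA hω hr hx
  exact ⟨u, hu, fun w hw => hu.eqOn hA hω hx hw⟩

lemma isMildSolution_semigroup {x : X} (hx : x ∈ semigroupDomain A) :
    IsMildSolution A x (fun t => semigroup A t x) := by
  have : (fun t => semigroup A t x) = hx.choose := by
    funext t
    exact dif_pos hx
  rw [this]
  exact hx.choose_spec.1

/-- The distance from a mild solution to an implicit Euler scheme. -/
theorem IsMildSolutionOn.norm_sub_euler_le (hA : IsOmegaAccretive ω A) (hω : 0 ≤ ω)
    {η r W T : ℝ} (hη : 0 < η) (hη1 : η ≤ 1) (hηω : ω * η ^ 2 ≤ 1 / 2) {x : X} {u : ℝ → X}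
    (hu : IsMildSolutionOn A x T u) {z w : X} (hz : (z, w) ∈ A) (hr : ‖x - z‖ ≤ r)
    (hW : ‖w‖ ≤ W) {h : ℝ} (hh : 0 < h) (hhη : h ≤ η ^ 2 / 2) {v : ℕ → X} (hv0 : v 0 = x)
    (hv : ∀ i, (v i, v (i + 1)) ∈ opResolvent h A) {s : ℝ} (hs : s ∈ Icc 0 T) {j : ℕ}
    (hj : |j * h - s| ≤ h) :
    ‖u s - v j‖ ≤
      η ^ 2 + Real.exp (4 * ω * (T + 2)) * (2 * r + 4 * η ^ 2 + W * (1 + (T + 2)) * η) := by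
  have hη2 : η ^ 2 ≤ 1 := pow_le_one₀ hη.le hη1
  have hη2' : 0 < η ^ 2 := by positivity
  obtain ⟨N, t, v', θ, hv', hn⟩ := hu.2.2 (η ^ 2 / 2) (by positivity)
  obtain ⟨i, hi, hti, hui⟩ := hn.exists_index hv'.discretization hs
  have hE := isApproxSolution_of_resolvent (N := j + 1) hh hhη (by omega) hv0 hv
  have hjh := (abs_le.1 hj).2
  have key := hv'.norm_sub_le_of_le hA hω hη hη1 hηω (by linarith) (show T ≤ T + 2 by linarith) hE
    (by linarith) (by push_cast; linarith [hs.2]) hz hr hW hi (Nat.le_succ j) (by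
      have := abs_sub_le (t i) s (j * h)
      rw [abs_sub_comm s] at this
      linarith)
  have := norm_sub_le_norm_sub_add_norm_sub (u s) (v' i) (v j)
  linarith

/-- Comparison with some `(z, w) ∈ A` near `x` gives `‖p - z‖ ≤ 2(‖x - z‖ + c‖w‖)` once `cω ≤ 1/2`.
The bounds `r/6` and `r/4` then add up to `r/6 + 2(r/6 + r/4) = r`. -/
lemma exists_forall_resolvent_norm_sub_lt (hA : IsOmegaAccretive ω A) (hω : 0 ≤ ω) {x : X}
    (hx : x ∈ closure A.dom) {r : ℝ} (hr : 0 < r) :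
    ∃ ρ : ℝ, 0 < ρ ∧ ∀ c ∈ Ioo 0 ρ, ∀ p : X, (x, p) ∈ opResolvent c A → ‖x - p‖ < r := by
  obtain ⟨z, w, hz, hxz⟩ := exists_mem_norm_sub_lt hx (show 0 < r / 6 by positivity)
  refine ⟨min (1 / (2 * (ω + 1))) (r / (4 * (‖w‖ + 1))), by positivity, fun c hc p hp => ?_⟩
  have hc0 := hc.1
  have hc1 := hc.2.trans_le (min_le_left _ _)
  have hc2 := hc.2.trans_le (min_le_right _ _)
  rw [lt_div_iff₀ (by positivity)] at hc1 hc2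
  have hcω : c * ω ≤ 1 / 2 := by linarith
  have key := hA.norm_step_sub_le (θ := 0) hc0 (by linarith) ((mem_opResolvent_iff hc0.ne').1 hp)
    (show c⁻¹ • (p - x) + c⁻¹ • (x - p) = 0 by rw [← smul_add]; simp) hz
  rw [norm_zero, mul_zero, add_zero] at key
  have h1 : 1 / 2 * ‖p - z‖ ≤ (1 - c * ω) * ‖p - z‖ :=
    mul_le_mul_of_nonneg_right (by linarith) (norm_nonneg _)
  have h2 := norm_sub_le_norm_sub_add_norm_sub x z p
  rw [norm_sub_rev z] at h2
  linarith

end MildSolutions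

/-! ### Convergence of the semigroups along the stacking -/

section Convergence

variable {X : ℕ∞ → Type*} [∀ n, NormedAddCommGroup (X n)] [∀ n, NormedSpace ℝ (X n)]
  {M : Type*} [MetricSpace M] {ξ : ∀ n, X n → M}

lemma IsBanachStacking.sub (hξ : IsBanachStacking ξ) {x y : ∀ n, X n} (hx : Converges ξ x)
    (hy : Converges ξ y) : Converges ξ (fun n => x n - y n) := by
  have := hξ.add _ _ hx (hξ.smul (-1) _ hy)
  simpa only [neg_one_smul, ← sub_eq_add_neg] using this

lemma IsBanachStacking.dist_le (hξ : IsBanachStacking ξ) (n : ℕ∞) (a b : X n) :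
    dist (ξ n a) (ξ n b) ≤ ‖a - b‖ := by
  simpa [dist_eq_norm] using (hξ.lipschitz n).dist_le_mul a b

/-- Resolvent convergence implies locally uniform convergence of the semigroups. -/
theorem tendstoUniformlyOn_semigroup (hξ : IsBanachStacking ξ) {A : ∀ n, SetRel (X n) (X n)}
    {ω δ : ℝ} (hω : 0 ≤ ω) (hA : ∀ n, IsOmegaAccretive ω (A n)) (hδ : 0 < δ)
    (hres : ∀ c ∈ Ioo (0 : ℝ) δ, ∀ z : ∀ n, X n, (∀ n, z n ∈ closure (A n).dom) → Converges ξ z →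
      ∃ w : ∀ n, X n, (∀ n, (z n, w n) ∈ opResolvent c (A n)) ∧ Converges ξ w)
    {x : ∀ n, X n} (hx : ∀ n, x n ∈ closure (A n).dom) (hxc : Converges ξ x)
    (hdom : ∀ n, x n ∈ semigroupDomain (A n)) {T : ℝ} (hT : 0 < T) :
    TendstoUniformlyOn (fun (n : ℕ) (t : ℝ) => ξ (n : ℕ∞) (semigroup (A n) t (x n)))
      (fun t : ℝ => ξ ⊤ (semigroup (A ⊤) t (x ⊤))) atTop (Icc 0 T) := by
  rw [Metric.tendstoUniformlyOn_iff]
  intro ε hε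
  set C := Real.exp (4 * ω * (T + 2))
  have hC0 : 0 < C := Real.exp_pos _
  set r := ε / (12 * C) with hr
  have hr0 : 0 < r := by positivity
  have hCr : C * (2 * r) < ε / 3 := by
    have : C * (2 * r) = ε / 6 := by rw [hr]; field_simp; norm_num
    linarith
  obtain ⟨ρ, hρ, hρr⟩ := exists_forall_resolvent_norm_sub_lt (hA ⊤) hω (hx ⊤) hr0
  set c := min ρ δ / 2 with hc
  have hc0 : 0 < c := by positivity
  have hcρ : c < ρ := by linarith [min_le_left ρ δ]
  have hcδ : c < δ := by linarith [min_le_right ρ δ]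
  -- The comparison points `z_n = p n`, with `w_n = c⁻¹(x_n - p n)` bounded by `W` whenever `‖x_n -
  -- p n‖ < r`.
  obtain ⟨p, hp, hpc⟩ := hres c ⟨hc0, hcδ⟩ x hx hxc
  have hnorm := hξ.norm _ (hξ.sub hxc hpc)
  have hr_top : ‖x ⊤ - p ⊤‖ < r := hρr c ⟨hc0, hcρ⟩ _ (hp ⊤)
  set W := c⁻¹ * r
  -- `η`, and hence the Euler step `h`, depends on `r` and `W` but not on `n`.
  obtain ⟨η, hη, hη1, hηω, hsmall⟩ := exists_small_parameter C W (1 + (T + 2)) ω hCr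
  have hm1 := min_le_left (η ^ 2 / 2) (δ / 2)
  have hm2 := min_le_right (η ^ 2 / 2) (δ / 2)
  set h := min (η ^ 2 / 2) (δ / 2)
  have hh0 : 0 < h := by positivity
  obtain ⟨v, hv0, hv⟩ := exists_seq_of_forall_exists
    (C := fun z : ∀ n, X n => (∀ n, z n ∈ closure (A n).dom) ∧ Converges ξ z)
    -- Only `R` survives the recursion, so it also records the convergence of the current term.
    (R := fun z w => (∀ n, (z n, w n) ∈ opResolvent h (A n)) ∧ Converges ξ z)
    (fun z hz => by
      obtain ⟨w, hw, hwc⟩ := hres h ⟨hh0, by linarith⟩ z hz.1 hz.2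
      exact ⟨w, ⟨fun n => subset_closure ⟨_, (mem_opResolvent_iff hh0.ne').1 (hw n)⟩, hwc⟩,
        hw, hz.2⟩) ⟨hx, hxc⟩
  have hest : ∀ n, ‖x n - p n‖ < r → ∀ s ∈ Icc 0 T,
      ‖semigroup (A n) s (x n) - v ⌈s / h⌉₊ n‖ < ε / 3 := by
    intro n hn s hs
    refine lt_of_le_of_lt ?_ hsmall
    refine (isMildSolution_semigroup (hdom n) T hT).norm_sub_euler_le (hA n) hω hη hη1 hηω
      ((mem_opResolvent_iff hc0.ne').1 (hp n)) hn.le ?_ hh0 hm1 (v := fun i => v i n)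
      (by rw [hv0]) (fun i => (hv i).1 n) hs (abs_natCeil_mul_sub_le hs.1 hh0)
    rw [norm_smul, Real.norm_of_nonneg (inv_nonneg.2 hc0.le)]
    exact mul_le_mul_of_nonneg_left hn.le (inv_nonneg.2 hc0.le)
  have hgrid : ∀ᶠ n : ℕ in atTop, ∀ j ∈ Finset.range (⌈T / h⌉₊ + 1),
      dist (ξ (n : ℕ∞) (v j n)) (ξ ⊤ (v j ⊤)) < ε / 3 := by
    rw [Filter.eventually_all_finset]
    exact fun j _ => Metric.tendsto_nhds.1 (hv j).2 _ (by positivity)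
  filter_upwards [hgrid, hnorm.eventually_lt_const hr_top] with n hn hnr s hs
  have hj : ⌈s / h⌉₊ ∈ Finset.range (⌈T / h⌉₊ + 1) := by
    rw [Finset.mem_range, Nat.lt_succ_iff]
    exact Nat.ceil_mono (div_le_div_of_nonneg_right hs.2 hh0.le)
  have h1 := (hξ.dist_le _ _ _).trans_lt (hest ⊤ hr_top s hs)
  have h2 := hn _ hj
  have h3 := (hξ.dist_le _ _ _).trans_lt (hest n hnr s hs)
  rw [dist_comm] at h2 h3
  linarith [dist_triangle4 (ξ ⊤ (semigroup (A ⊤) s (x ⊤))) (ξ ⊤ (v ⌈s / h⌉₊ ⊤))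
    (ξ (n : ℕ∞) (v ⌈s / h⌉₊ n)) (ξ (n : ℕ∞) (semigroup (A n) s (x n)))]

end Convergence

end BanachStacking

open BanachStacking in
theorem mainTheorem1 {X : ℕ∞ → Type*} [∀ n, NormedAddCommGroup (X n)]
    [∀ n, NormedSpace ℝ (X n)] [∀ n, CompleteSpace (X n)] {M : Type*} [MetricSpace M]
    (ξ : ∀ n, X n → M) (hξ : IsBanachStacking ξ)
    (ωseq : ℕ∞ → ℝ) (ω : ℝ) (hω : ∀ n, ωseq n ≤ ω)
    (A : ∀ n, SetRel (X n) (X n))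
    (hA : ∀ n, IsOmegaAccretive (ωseq n) (A n))
    (hrange : ∀ n, RangeCondition (A n))
    (hres : ∃ δ ∈ omegaInterval ω, ∀ c ∈ Set.Ioo (0 : ℝ) δ,
      ∀ z : ∀ n, X n, (∀ n, z n ∈ closure (A n).dom) → Converges ξ z →
        ∃ w : ∀ n, X n, (∀ n, (z n, w n) ∈ opResolvent c (A n)) ∧ Converges ξ w) :
    ∀ x : ∀ n, X n, (∀ n, x n ∈ closure (A n).dom) → Converges ξ x →
      (∀ n, x n ∈ semigroupDomain (A n)) ∧
      (∀ t : ℝ, 0 ≤ t → Converges ξ (fun n => semigroup (A n) t (x n))) ∧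
      (∀ T : ℝ, 0 ≤ T →
        TendstoUniformlyOn (fun (n : ℕ) (t : ℝ) => ξ (n : ℕ∞) (semigroup (A n) t (x n)))
          (fun t : ℝ => ξ ⊤ (semigroup (A ⊤) t (x ⊤))) Filter.atTop (Set.Icc 0 T)) := by
  intro x hx hxc
  -- A common nonnegative constant makes the growth factors nondecreasing in time and independent of
  -- `n`.
  have hω' : 0 ≤ max ω 0 := le_max_right _ _
  have hA' : ∀ n, IsOmegaAccretive (max ω 0) (A n) := fun n =>
    (hA n).mono ((hω n).trans (le_max_left _ _))
  have hdom : ∀ n, x n ∈ semigroupDomain (A n) := fun n =>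
    closure_dom_subset_semigroupDomain (hA' n) hω' (hrange n) (hx n)
  obtain ⟨δ, hδ, hres⟩ := hres
  refine ⟨hdom, fun t ht => ?_, fun T hT => ?_⟩
  · exact (tendstoUniformlyOn_semigroup hξ hω' hA' hδ.1 hres hx hxc hdom
      (T := t + 1) (by linarith)).tendsto_at ⟨ht, by linarith⟩
  · exact (tendstoUniformlyOn_semigroup hξ hω' hA' hδ.1 hres hx hxc hdom
      (T := T + 1) (by linarith)).mono (Set.Icc_subset_Icc_right (by linarith))
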